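/- Let $(\bar M, J, g)$ be a Kaehler manifold: a smooth finite-dimensional Riemannian manifold with a smooth endomorphism field $J$ of $T\bar M$ such that $J^2=-I$, $g(JX,JY)=g(X,Y)$ and $\bar\nabla J=0$, where $\bar\nabla$ is the Levi-Civita connection. Let $(M_1,g_1)$ be a connected Riemannian manifold, let $M_{\theta_1}$ and $M_{\theta_2}$ be non-empty smooth manifolds with $\dim M_{\theta_2}>0$, and let $g_2$ be a Riemannian metric on $M_2=M_{\theta_1}\times M_{\theta_2}$ (for instance a product metric). All these manifolds are smooth, finite-dimensional and without boundary. Let $f:M_1\to(0,\infty)$ be a differentiable function, and let $M=M_1\times_f M_2$ be the warped product, that is, $M_1\times M_2$ with the metric $$g_1(\pi_*X,\pi_*Y)+(f\circ\pi)^2\,g_2(\rho_*X,\rho_*Y),$$ where $\pi$ and $\rho$ are the projections to $M_1$ and $M_2$. Let $M$ be smoothly and isometrically immersed in $\bar M$, and let $D$, $D_1$, $D_2$ be the distributions on $M$ tangent to the factors $M_1$, $M_{\theta_1}$, $M_{\theta_2}$. Suppose that $M$ is a quasi bi-slant submanifold of $\bar M$ with respect to $D,D_1,D_2$, with slant angles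 $\theta_1,\theta_2$: $TM=D\oplus D_1\oplus D_2$ is an orthogonal direct sum, $J D=D$, $J D_1\perp D_2$, and for $i=1,2$, every $p\in M$ and every non-zero $X\in (D_i)_p$, the angle between $JX$ and the subspace $(D_i)_p$ equals $\theta_i$. Then at least one of the following two cases occurs: 1. The warping function $f$ is constant, and $M$ is a Riemannian product: its metric is the product of $g_1$ and a Riemannian metric on $M_2$. 2. $\theta_2=\pi/2$, and $M$ is a warped product quasi hemi-slant submanifold with respect to $D$ (invariant, $JD=D$), $D_1$ (slant with slant angle $\theta_1$) and $D_2$ (anti-invariant, $J D_2\subseteq T^\perp M$). In particular every leaf $\{x\}\times\{a\}\times M_{\theta_2}$ is a totally real submanifold $M_\perp$ of $\bar M$, i.e. $J$ maps its tangent spaces into its normal spaces. -/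

import Mathlib

open Bundle Manifold
open scoped ContDiff

noncomputable section

namespace SlantGeometry

/-! ### Kaehler manifolds -/

section Kaehler

variable {E : Type*} [NormedAddCommGroup E] [NormedSpace ℝ E]
  {N : Type*} [TopologicalSpace N] [ChartedSpace E N]

/-- The angle (in `[0, π / 2]`) between a vector `v` and a subspace `W` of an inner product space:
the angle between `v` and its orthogonal projection to `W`. It equals `π / 2` exactly if the
projection vanishes, that is, if `v` is orthogonal to `W`. -/
def angleToSubspace {V : Type*} [NormedAddCommGroup V] [InnerProductSpace ℝ V]
    (v : V) (W : Submodule ℝ V) [W.HasOrthogonalProjection] : ℝ :=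
  InnerProductGeometry.angle v (W.starProjection v)

instance finiteDimensional_tangentSpace [FiniteDimensional ℝ E] (x : N) :
    FiniteDimensional ℝ (TangentSpace 𝓘(ℝ, E) x) :=
  inferInstanceAs (FiniteDimensional ℝ E)

variable [FiniteDimensional ℝ E] [IsManifold 𝓘(ℝ, E) ∞ N]
  [RiemannianBundle (fun x : N ↦ TangentSpace 𝓘(ℝ, E) x)]
  [IsContMDiffRiemannianBundle 𝓘(ℝ, E) ∞ E (fun x : N ↦ TangentSpace 𝓘(ℝ, E) x)]

/-- A connection on the tangent bundle of a Riemannian manifold is a Levi-Civita connection if it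
is compatible with the metric and torsion free. -/
structure IsLeviCivita
    (cov : CovariantDerivative 𝓘(ℝ, E) E (fun x : N ↦ TangentSpace 𝓘(ℝ, E) x)) : Prop where
  metric : @CovariantDerivative.IsMetricCompatible E _ _ E _ 𝓘(ℝ, E) N _ _ E _ _
    (fun x : N ↦ TangentSpace 𝓘(ℝ, E) x) _ (fun _ ↦ inferInstance) (fun _ ↦ inferInstance)
    _ cov _ _ _ _
  torsion_free : cov.torsion = 0

/-- `J` makes the Riemannian manifold `N` a Kaehler manifold: `J` is a smooth endomorphism field of
the tangent bundle with `J² = -1`, it is orthogonal for the metric, and it is parallel for the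
Levi-Civita connection, `∇_X (J Y) = J (∇_X Y)`. The condition in the last field does not
depend on the choice of `cov`: any two Levi-Civita connections agree on differentiable fields. -/
structure IsKaehler
    (J : ∀ x : N, TangentSpace 𝓘(ℝ, E) x →L[ℝ] TangentSpace 𝓘(ℝ, E) x) : Prop where
  smooth : ContMDiff 𝓘(ℝ, E) (𝓘(ℝ, E).prod 𝓘(ℝ, E →L[ℝ] E)) ∞
    (fun x ↦ TotalSpace.mk' (E →L[ℝ] E)
      (E := fun x : N ↦ TangentSpace 𝓘(ℝ, E) x →L[ℝ] TangentSpace 𝓘(ℝ, E) x) x (J x))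
  sq_eq_neg : ∀ (x : N) (v : TangentSpace 𝓘(ℝ, E) x), J x (J x v) = -v
  inner_map_map : ∀ (x : N) (v w : TangentSpace 𝓘(ℝ, E) x),
    inner ℝ (J x v) (J x w) = inner ℝ v w
  parallel : ∃ cov : CovariantDerivative 𝓘(ℝ, E) E (fun x : N ↦ TangentSpace 𝓘(ℝ, E) x),
    IsLeviCivita cov ∧
      ∀ (Y : ∀ x : N, TangentSpace 𝓘(ℝ, E) x) (x : N) (v : TangentSpace 𝓘(ℝ, E) x),
        MDifferentiableAt 𝓘(ℝ, E) (𝓘(ℝ, E).prod 𝓘(ℝ, E))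
          (fun y ↦ (TotalSpace.mk' E y (Y y) : TangentBundle 𝓘(ℝ, E) N)) x →
        cov (fun y ↦ J y (Y y)) x v = J x (cov Y x v)

end Kaehler

/-! ### Submanifolds of almost Hermitian manifolds

A submanifold is given by an immersion `χ : M → N`; conditions on vectors tangent to `M` are read
in the tangent spaces of `N`, through the differential of `χ`. A distribution on `M` is
given by its fibers `D p ≤ T_p M`. -/

section Submanifolds

variable {E : Type*} [NormedAddCommGroup E] [NormedSpace ℝ E] [FiniteDimensional ℝ E]
  {N : Type*} [TopologicalSpace N] [ChartedSpace E N]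
  [RiemannianBundle (fun x : N ↦ TangentSpace 𝓘(ℝ, E) x)]
  {F : Type*} [NormedAddCommGroup F] [NormedSpace ℝ F]
  {H : Type*} [TopologicalSpace H] {I : ModelWithCorners ℝ F H}
  {M : Type*} [TopologicalSpace M] [ChartedSpace H M]

/-- `χ` is a smooth isometric immersion of `M`, with the metric `g`, into `N`.
(If `g` is positive definite, every differential of `χ` is injective.) -/
structure IsIsometricImmersion (I : ModelWithCorners ℝ F H)
    (g : ∀ p : M, TangentSpace I p → TangentSpace I p → ℝ) (χ : M → N) : Prop where
  smooth : ContMDiff I 𝓘(ℝ, E) ∞ χ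
  isometric : ∀ (p : M) (u v : TangentSpace I p),
    inner ℝ (mfderiv I 𝓘(ℝ, E) χ p u) (mfderiv I 𝓘(ℝ, E) χ p v) = g p u v

/-- The fiber at `p` of the distribution `D`, as a subspace of the tangent space of `N`. -/
def push (χ : M → N) (D : ∀ p : M, Submodule ℝ (TangentSpace I p)) (p : M) :
    Submodule ℝ (TangentSpace 𝓘(ℝ, E) (χ p)) :=
  (D p).map (mfderiv I 𝓘(ℝ, E) χ p).toLinearMap

variable (J : ∀ x : N, TangentSpace 𝓘(ℝ, E) x →L[ℝ] TangentSpace 𝓘(ℝ, E) x) (χ : M → N)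

/-- `TM = D ⊕ D₁ ⊕ D₂`, an orthogonal direct sum. (For an immersion `χ`, a sum of pairwise
orthogonal subspaces is direct.) -/
structure IsOrthogonalSplitting (χ : M → N) (D D₁ D₂ : ∀ p : M, Submodule ℝ (TangentSpace I p)) : Prop where
  sup_eq_top : ∀ p, D p ⊔ D₁ p ⊔ D₂ p = ⊤
  ortho_one : ∀ p, ∀ u ∈ push (E := E) χ D p, ∀ v ∈ push (E := E) χ D₁ p, inner ℝ u v = 0
  ortho_two : ∀ p, ∀ u ∈ push (E := E) χ D p, ∀ v ∈ push (E := E) χ D₂ p, inner ℝ u v = 0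
  ortho_one_two : ∀ p, ∀ u ∈ push (E := E) χ D₁ p, ∀ v ∈ push (E := E) χ D₂ p, inner ℝ u v = 0

/-- `J D = D`. -/
def IsInvariantDistribution (D : ∀ p : M, Submodule ℝ (TangentSpace I p)) : Prop :=
  ∀ p, (push χ D p).map (J (χ p)).toLinearMap = push χ D p

/-- `D` is slant with slant angle `θ`: for every `p` and every non-zero `u ∈ D p`, the angle
between `J u` and `D p` is `θ`. -/
def IsSlantDistribution (D : ∀ p : M, Submodule ℝ (TangentSpace I p)) (θ : ℝ) : Prop :=
  ∀ p, ∀ u ∈ push (E := E) χ D p, u ≠ 0 → angleToSubspace (J (χ p) u) (push χ D p) = θ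

/-- `D` is anti-invariant: `J D ⊆ T^⊥ M`. -/
def IsAntiInvariantDistribution (D : ∀ p : M, Submodule ℝ (TangentSpace I p)) : Prop :=
  ∀ p, ∀ u ∈ push (E := E) χ D p, ∀ v : TangentSpace I p,
    inner ℝ (J (χ p) u) (mfderiv I 𝓘(ℝ, E) χ p v) = 0

/-- A totally real (anti-invariant) submanifold: `J (T_p M) ⊆ T_p^⊥ M` for all `p`. -/
def IsTotallyReal (I : ModelWithCorners ℝ F H) : Prop :=
  IsAntiInvariantDistribution J χ (fun p : M ↦ (⊤ : Submodule ℝ (TangentSpace I p)))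

/-- `χ : M → N` is a quasi bi-slant submanifold with respect to the distributions `D` (invariant),
`D₁` and `D₂` (slant), with slant angles `θ₁` and `θ₂`. -/
structure IsQuasiBiSlant (D D₁ D₂ : ∀ p : M, Submodule ℝ (TangentSpace I p)) (θ₁ θ₂ : ℝ) :
    Prop where
  splitting : IsOrthogonalSplitting (E := E) χ D D₁ D₂
  invariant : IsInvariantDistribution J χ D
  ortho : ∀ p, ∀ u ∈ push (E := E) χ D₁ p, ∀ v ∈ push (E := E) χ D₂ p, inner ℝ (J (χ p) u) v = 0
  slant_one : IsSlantDistribution J χ D₁ θ₁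
  slant_two : IsSlantDistribution J χ D₂ θ₂

/-- `χ : M → N` is a quasi hemi-slant submanifold with respect to the distributions `D`
(invariant), `Dθ` (slant with slant angle `θ`) and `Dperp` (anti-invariant). -/
structure IsQuasiHemiSlant (D Dθ Dperp : ∀ p : M, Submodule ℝ (TangentSpace I p)) (θ : ℝ) :
    Prop where
  splitting : IsOrthogonalSplitting (E := E) χ D Dθ Dperp
  invariant : IsInvariantDistribution J χ D
  slant : IsSlantDistribution J χ Dθ θ
  anti_invariant : IsAntiInvariantDistribution J χ Dperp

end Submanifolds

/-! ### Warped products -/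

section Warped

variable {E₁ : Type*} [NormedAddCommGroup E₁] [NormedSpace ℝ E₁]
  {H₁ : Type*} [TopologicalSpace H₁] {I₁ : ModelWithCorners ℝ E₁ H₁}
  {M₁ : Type*} [TopologicalSpace M₁] [ChartedSpace H₁ M₁] [IsManifold I₁ ∞ M₁]
  {E₂ : Type*} [NormedAddCommGroup E₂] [NormedSpace ℝ E₂]
  {H₂ : Type*} [TopologicalSpace H₂] {I₂ : ModelWithCorners ℝ E₂ H₂}
  {M₂ : Type*} [TopologicalSpace M₂] [ChartedSpace H₂ M₂] [IsManifold I₂ ∞ M₂]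

/-- The warped product metric `g(u, v) = g₁(π_* u, π_* v) + f² g₂(ρ_* u, ρ_* v)` on `M₁ × M₂`,
where `π` and `ρ` are the two projections. -/
def warpedMetric (g₁ : ContMDiffRiemannianMetric I₁ ∞ E₁ (fun x : M₁ ↦ TangentSpace I₁ x))
    (f : M₁ → ℝ)
    (g₂ : ContMDiffRiemannianMetric I₂ ∞ E₂ (fun y : M₂ ↦ TangentSpace I₂ y))
    (p : M₁ × M₂) (u v : TangentSpace (I₁.prod I₂) p) : ℝ :=
  g₁.inner p.1 (mfderiv (I₁.prod I₂) I₁ Prod.fst p u) (mfderiv (I₁.prod I₂) I₁ Prod.fst p v) +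
    f p.1 ^ 2 * g₂.inner p.2 (mfderiv (I₁.prod I₂) I₂ Prod.snd p u)
      (mfderiv (I₁.prod I₂) I₂ Prod.snd p v)

/-- The metric of the Riemannian product of `(M₁, g₁)` and `(M₂, g₂)`. -/
def productMetric (g₁ : ContMDiffRiemannianMetric I₁ ∞ E₁ (fun x : M₁ ↦ TangentSpace I₁ x))
    (g₂ : ContMDiffRiemannianMetric I₂ ∞ E₂ (fun y : M₂ ↦ TangentSpace I₂ y))
    (p : M₁ × M₂) (u v : TangentSpace (I₁.prod I₂) p) : ℝ :=
  g₁.inner p.1 (mfderiv (I₁.prod I₂) I₁ Prod.fst p u) (mfderiv (I₁.prod I₂) I₁ Prod.fst p v) +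
    g₂.inner p.2 (mfderiv (I₁.prod I₂) I₂ Prod.snd p u)
      (mfderiv (I₁.prod I₂) I₂ Prod.snd p v)

end Warped

/-! ### The distributions tangent to the factors of `M₁ × (A × B)` -/

section Factors

variable (E₁ : Type*) [NormedAddCommGroup E₁] [NormedSpace ℝ E₁]
  {M₁ : Type*} [TopologicalSpace M₁] [ChartedSpace E₁ M₁]
  (F₁ : Type*) [NormedAddCommGroup F₁] [NormedSpace ℝ F₁]
  {A : Type*} [TopologicalSpace A] [ChartedSpace F₁ A]
  (F₂ : Type*) [NormedAddCommGroup F₂] [NormedSpace ℝ F₂]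
  {B : Type*} [TopologicalSpace B] [ChartedSpace F₂ B]

/-- The tangent spaces of the leaves `M₁ × {(a, b)}`. -/
def tangentFirst (p : M₁ × (A × B)) :
    Submodule ℝ (TangentSpace (𝓘(ℝ, E₁).prod (𝓘(ℝ, F₁).prod 𝓘(ℝ, F₂))) p) :=
  (mfderiv 𝓘(ℝ, E₁) (𝓘(ℝ, E₁).prod (𝓘(ℝ, F₁).prod 𝓘(ℝ, F₂)))
    (fun x : M₁ ↦ (x, (p.2.1, p.2.2))) p.1).toLinearMap.range

/-- The tangent spaces of the leaves `{x} × A × {b}`. -/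
def tangentSecond (p : M₁ × (A × B)) :
    Submodule ℝ (TangentSpace (𝓘(ℝ, E₁).prod (𝓘(ℝ, F₁).prod 𝓘(ℝ, F₂))) p) :=
  (mfderiv 𝓘(ℝ, F₁) (𝓘(ℝ, E₁).prod (𝓘(ℝ, F₁).prod 𝓘(ℝ, F₂)))
    (fun a : A ↦ (p.1, (a, p.2.2))) p.2.1).toLinearMap.range

/-- The tangent spaces of the leaves `{x} × {a} × B`. -/
def tangentThird (p : M₁ × (A × B)) :
    Submodule ℝ (TangentSpace (𝓘(ℝ, E₁).prod (𝓘(ℝ, F₁).prod 𝓘(ℝ, F₂))) p) :=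
  (mfderiv 𝓘(ℝ, F₂) (𝓘(ℝ, E₁).prod (𝓘(ℝ, F₁).prod 𝓘(ℝ, F₂)))
    (fun b : B ↦ (p.1, (p.2.1, b))) p.2.2).toLinearMap.range

end Factors

end SlantGeometry

end

noncomputable section

namespace SlantGeometry

open VectorField Filter Topology

/-! The Kaehler form `Ω(X, Y) = ⟨J X, Y⟩` is closed, because `J` is parallel for a torsion-free
metric connection. Fix a point `a` of `M_θ₁` and pull `Ω` back to `M₁ × {a} × M_θ₂`. Its mixed part
vanishes: `J D = D` is orthogonal to `D₂`. For `X` along `M₁` and `Z`, `W` along `M_θ₂`, coming from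
coordinates and hence commuting, `dΩ(X, Z, W) = 0` reduces to `X Ω(Z, W) = 0`. Since `M₁` is
connected, the form induced on the leaf `{x} × {a} × M_θ₂` does not depend on `x`
(`IsKaehler.pullbackForm_eq_of_mixed_eq_zero`).

The metric induced on that leaf is `f(x)²` times a metric independent of `x`. The operator
representing a fixed form then scales by `f(x)⁻²`, whereas slantness makes it `cos θ₂` times a
norm-preserving map for every `x`. If `cos θ₂ ≠ 0`, then `f` is constant
(`le_of_slant_of_inner_eq`). Otherwise `θ₂ = π / 2`, and `J D₂` is orthogonal to `D`, `D₁` and `D₂`,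
hence normal to `M` (`IsQuasiBiSlant.isAntiInvariantDistribution`). -/

/-! ### Pullback of closed 2-forms between normed spaces -/

set_option synthInstance.maxHeartbeats 200000 in
/-- If a skew form `η` satisfies the cyclic identity for closed forms at `G p`, then so does its
pullback by `G` at `p`. -/
lemma cyclic_fderiv_pullback_eq_zero {V E : Type*} [NormedAddCommGroup V] [NormedSpace ℝ V]
    [NormedAddCommGroup E] [NormedSpace ℝ E] {G : V → E} {p : V} (hG : ContDiffAt ℝ 2 G p)
    {η : E → E →L[ℝ] E →L[ℝ] ℝ} (hη : DifferentiableAt ℝ η (G p))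
    (hskew : ∀ u v, η (G p) u v = -η (G p) v u)
    (hclosed : ∀ u v w, fderiv ℝ η (G p) u v w + fderiv ℝ η (G p) v w u +
      fderiv ℝ η (G p) w u v = 0) :
    (∀ a b, DifferentiableAt ℝ (fun q ↦ η (G q) (fderiv ℝ G q a) (fderiv ℝ G q b)) p) ∧
    ∀ a b c, fderiv ℝ (fun q ↦ η (G q) (fderiv ℝ G q b) (fderiv ℝ G q c)) p a +
      fderiv ℝ (fun q ↦ η (G q) (fderiv ℝ G q c) (fderiv ℝ G q a)) p b +
      fderiv ℝ (fun q ↦ η (G q) (fderiv ℝ G q a) (fderiv ℝ G q b)) p c = 0 := by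
  have hG1 : HasFDerivAt G (fderiv ℝ G p) p :=
    (hG.differentiableAt (by norm_num)).hasFDerivAt
  have hG2 : HasFDerivAt (fderiv ℝ G) (fderiv ℝ (fderiv ℝ G) p) p :=
    ((hG.fderiv_right (m := 1) (by norm_num)).differentiableAt (by norm_num)).hasFDerivAt
  have hsymm : ∀ a b, fderiv ℝ (fderiv ℝ G) p a b = fderiv ℝ (fderiv ℝ G) p b a :=
    fun a b ↦ (hG.isSymmSndFDerivAt (by simp)).eq a b
  have hη1 : HasFDerivAt (fun q ↦ η (G q)) ((fderiv ℝ η (G p)).comp (fderiv ℝ G p)) p :=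
    HasFDerivAt.comp (g := η) p hη.hasFDerivAt hG1
  have hG3 : ∀ a, HasFDerivAt (fun q ↦ fderiv ℝ G q a) ((fderiv ℝ (fderiv ℝ G) p).flip a) p :=
    fun a ↦ by simpa using hG2.clm_apply (hasFDerivAt_const a p)
  have key := fun a b ↦ (hη1.clm_apply (hG3 a)).clm_apply (hG3 b)
  refine ⟨fun a b ↦ (key a b).differentiableAt, fun a b c ↦ ?_⟩
  rw [(key b c).fderiv, (key c a).fderiv, (key a b).fderiv]
  have h := hclosed (fderiv ℝ G p a) (fderiv ℝ G p b) (fderiv ℝ G p c)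
  simp only [add_apply, ContinuousLinearMap.comp_apply, ContinuousLinearMap.flip_apply]
  -- The six terms containing second derivatives of `G` cancel in pairs: the second derivative is
  -- symmetric and `η` is skew.
  rw [hsymm c b, hsymm c a, hsymm b a,
    hskew (fderiv ℝ G p b) (fderiv ℝ (fderiv ℝ G) p a c),
    hskew (fderiv ℝ G p c) (fderiv ℝ (fderiv ℝ G) p a b),
    hskew (fderiv ℝ G p a) (fderiv ℝ (fderiv ℝ G) p b c)]
  linarith

/-! ### The Kaehler form in charts and its closedness -/

section

set_option linter.unusedSectionVars false

variable {E : Type*} [NormedAddCommGroup E] [NormedSpace ℝ E] [FiniteDimensional ℝ E]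
  {N : Type*} [TopologicalSpace N] [ChartedSpace E N] [IsManifold 𝓘(ℝ, E) ∞ N]

/-- The vector field on `N` with constant coordinates `u` in the chart at `y₀`. -/
def coordField (y₀ : N) (u : E) (y : N) : TangentSpace 𝓘(ℝ, E) y :=
  mpullback 𝓘(ℝ, E) 𝓘(ℝ, E) (extChartAt 𝓘(ℝ, E) y₀) (fun _ ↦ u) y

lemma coordField_add (y₀ : N) (u v : E) (y : N) :
    coordField y₀ (u + v) y = coordField y₀ u y + coordField y₀ v y :=
  ContinuousLinearMap.map_add _ _ _

lemma coordField_smul (y₀ : N) (c : ℝ) (u : E) (y : N) :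
    coordField y₀ (c • u) y = c • coordField y₀ u y :=
  ContinuousLinearMap.map_smul _ _ _

lemma contMDiffAt_const_field (u : E) (s : E) :
    ContMDiffAt 𝓘(ℝ, E) (𝓘(ℝ, E).prod 𝓘(ℝ, E)) 1
      (fun y ↦ (TotalSpace.mk' E y u : TangentBundle 𝓘(ℝ, E) E)) s :=
  contMDiffAt_vectorSpace_iff_contDiffAt.2 contDiffAt_const

lemma contMDiffAt_coordField {y₀ y : N} (hy : y ∈ (extChartAt 𝓘(ℝ, E) y₀).source) (u : E) :
    ContMDiffAt 𝓘(ℝ, E) (𝓘(ℝ, E).prod 𝓘(ℝ, E)) 1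
      (fun y ↦ (TotalSpace.mk' E y (coordField y₀ u y) : TangentBundle 𝓘(ℝ, E) N)) y :=
  ContMDiffAt.mpullback_vectorField_preimage (n := 2) (contMDiffAt_const_field u _)
    (contMDiffAt_extChartAt' (by simpa using hy)) (isInvertible_mfderiv_extChartAt hy)
    (by norm_num)

/-- Lie brackets are natural under pullback by the chart, and constant fields on `E` commute. -/
lemma mlieBracket_coordField {y₀ y : N} (hy : y ∈ (extChartAt 𝓘(ℝ, E) y₀).source) (u v : E) :
    mlieBracket 𝓘(ℝ, E) (coordField y₀ u) (coordField y₀ v) y = 0 := by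
  have : IsManifold 𝓘(ℝ, E) (minSmoothness ℝ 2) N := by
    rw [minSmoothness_of_isRCLikeNormedField]; infer_instance
  have := mpullback_mlieBracket (I := 𝓘(ℝ, E)) (I' := 𝓘(ℝ, E)) (n := 2)
    (f := extChartAt 𝓘(ℝ, E) y₀) (x₀ := y) ((contMDiffAt_const_field u _).mdifferentiableAt one_ne_zero)
    ((contMDiffAt_const_field v _).mdifferentiableAt one_ne_zero) (contMDiffAt_extChartAt' (by simpa using hy)) (by simp)
  refine this.symm.trans ?_
  have h0 : mlieBracket 𝓘(ℝ, E) (M := E) (fun _ ↦ u) (fun _ ↦ v) = 0 := by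
    refine mlieBracketWithin_univ.symm.trans (mlieBracketWithin_eq_lieBracketWithin.trans ?_)
    ext x
    simp [lieBracketWithin]
    rfl
  erw [h0]
  simp

variable [RiemannianBundle (fun x : N ↦ TangentSpace 𝓘(ℝ, E) x)]
  [IsContMDiffRiemannianBundle 𝓘(ℝ, E) ∞ E (fun x : N ↦ TangentSpace 𝓘(ℝ, E) x)]
  {J : ∀ x : N, TangentSpace 𝓘(ℝ, E) x →L[ℝ] TangentSpace 𝓘(ℝ, E) x}

lemma IsKaehler.inner_map_left_eq_neg (hJ : IsKaehler J) (x : N) (v w : TangentSpace 𝓘(ℝ, E) x) :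
    inner ℝ (J x v) w = -inner ℝ v (J x w) := by
  rw [← hJ.inner_map_map x v, hJ.sq_eq_neg, inner_neg_right, neg_neg]

lemma IsKaehler.inner_map_skew (hJ : IsKaehler J) (x : N) (v w : TangentSpace 𝓘(ℝ, E) x) :
    inner ℝ (J x v) w = -inner ℝ (J x w) v := by
  rw [hJ.inner_map_left_eq_neg, real_inner_comm]

lemma IsKaehler.contMDiffAt_map (hJ : IsKaehler J) {Y : ∀ x : N, TangentSpace 𝓘(ℝ, E) x}
    {x : N} (hY : ContMDiffAt 𝓘(ℝ, E) (𝓘(ℝ, E).prod 𝓘(ℝ, E)) 1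
      (fun y ↦ (TotalSpace.mk' E y (Y y) : TangentBundle 𝓘(ℝ, E) N)) x) :
    ContMDiffAt 𝓘(ℝ, E) (𝓘(ℝ, E).prod 𝓘(ℝ, E)) 1
      (fun y ↦ (TotalSpace.mk' E y (J y (Y y)) : TangentBundle 𝓘(ℝ, E) N)) x :=
  ContMDiffAt.clm_bundle_apply (E₁ := fun x : N ↦ TangentSpace 𝓘(ℝ, E) x)
    (E₂ := fun x : N ↦ TangentSpace 𝓘(ℝ, E) x) ((hJ.smooth x).of_le (by simp)) hY

/-- The Kaehler form is closed: the cyclic identity on commuting fields. -/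
lemma IsKaehler.cyclic_mvfderiv_eq_zero (hJ : IsKaehler J)
    {U V W : ∀ x : N, TangentSpace 𝓘(ℝ, E) x} {x : N}
    (hU : ContMDiffAt 𝓘(ℝ, E) (𝓘(ℝ, E).prod 𝓘(ℝ, E)) 1
      (fun y ↦ (TotalSpace.mk' E y (U y) : TangentBundle 𝓘(ℝ, E) N)) x)
    (hV : ContMDiffAt 𝓘(ℝ, E) (𝓘(ℝ, E).prod 𝓘(ℝ, E)) 1
      (fun y ↦ (TotalSpace.mk' E y (V y) : TangentBundle 𝓘(ℝ, E) N)) x)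
    (hW : ContMDiffAt 𝓘(ℝ, E) (𝓘(ℝ, E).prod 𝓘(ℝ, E)) 1
      (fun y ↦ (TotalSpace.mk' E y (W y) : TangentBundle 𝓘(ℝ, E) N)) x)
    (hUV : mlieBracket 𝓘(ℝ, E) U V x = 0) (hVW : mlieBracket 𝓘(ℝ, E) V W x = 0)
    (hWU : mlieBracket 𝓘(ℝ, E) W U x = 0) :
    mvfderiv 𝓘(ℝ, E) (fun y ↦ (inner ℝ (J y (V y)) (W y) : ℝ)) x (U x) +
      mvfderiv 𝓘(ℝ, E) (fun y ↦ (inner ℝ (J y (W y)) (U y) : ℝ)) x (V x) +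
      mvfderiv 𝓘(ℝ, E) (fun y ↦ (inner ℝ (J y (U y)) (V y) : ℝ)) x (W x) = 0 := by
  have mU := hU.mdifferentiableAt one_ne_zero
  have mV := hV.mdifferentiableAt one_ne_zero
  have mW := hW.mdifferentiableAt one_ne_zero
  obtain ⟨cov, hcov, hpar⟩ := hJ.parallel
  have tUV := cov.torsion_eq_zero_iff.1 hcov.torsion_free mU mV
  have tVW := cov.torsion_eq_zero_iff.1 hcov.torsion_free mV mW
  have tWU := cov.torsion_eq_zero_iff.1 hcov.torsion_free mW mU
  rw [hUV, sub_eq_zero] at tUV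
  rw [hVW, sub_eq_zero] at tVW
  rw [hWU, sub_eq_zero] at tWU
  have h1 := hcov.metric.mvfderiv_inner_eq U ((hJ.contMDiffAt_map hV).mdifferentiableAt one_ne_zero) mW
  have h2 := hcov.metric.mvfderiv_inner_eq V ((hJ.contMDiffAt_map hW).mdifferentiableAt one_ne_zero) mU
  have h3 := hcov.metric.mvfderiv_inner_eq W ((hJ.contMDiffAt_map hU).mdifferentiableAt one_ne_zero) mV
  -- Parallelism moves `J` out of the covariant derivatives. Vanishing torsion and brackets leave
  -- only three distinct derivatives, each occurring twice; skewness of `⟨J ·, ·⟩` cancels each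
  -- pair.
  simp only [hpar _ _ _ mU, hpar _ _ _ mV, hpar _ _ _ mW] at h1 h2 h3
  erw [h1, h2, h3, tUV, tVW, tWU]
  have e1 := hJ.inner_map_skew x (cov U x (V x)) (W x)
  have e2 := hJ.inner_map_skew x (cov V x (W x)) (U x)
  have e3 := hJ.inner_map_skew x (cov W x (U x)) (V x)
  erw [e1, e2, e3]
  ring

lemma IsKaehler.contMDiffAt_inner_coordField (hJ : IsKaehler J) {y₀ y : N}
    (hy : y ∈ (extChartAt 𝓘(ℝ, E) y₀).source) (u v : E) :
    ContMDiffAt 𝓘(ℝ, E) 𝓘(ℝ, ℝ) 1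
      (fun y ↦ (inner ℝ (J y (coordField y₀ u y)) (coordField y₀ v y) : ℝ)) y :=
  ContMDiffAt.inner_bundle (F := E) (E := fun x : N ↦ TangentSpace 𝓘(ℝ, E) x) (IB := 𝓘(ℝ, E))
    (b := fun y ↦ y) (hJ.contMDiffAt_map (contMDiffAt_coordField hy u)) (contMDiffAt_coordField hy v)

/-- The Kaehler form in the chart at `y₀`. -/
def coordForm (J : ∀ x : N, TangentSpace 𝓘(ℝ, E) x →L[ℝ] TangentSpace 𝓘(ℝ, E) x) (y₀ : N)
    (s : E) : E →L[ℝ] E →L[ℝ] ℝ :=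
  LinearMap.toContinuousBilinearMap <|
    LinearMap.mk₂ ℝ (fun u v ↦ (inner ℝ
      (J ((extChartAt 𝓘(ℝ, E) y₀).symm s) (coordField y₀ u ((extChartAt 𝓘(ℝ, E) y₀).symm s)))
      (coordField y₀ v ((extChartAt 𝓘(ℝ, E) y₀).symm s)) : ℝ))
      (fun u v w ↦ by simp only [coordField_add, map_add, inner_add_left])
      (fun c u v ↦ by simp only [coordField_smul, map_smul, real_inner_smul_left, smul_eq_mul])
      (fun u v w ↦ by simp only [coordField_add, inner_add_right])
      (fun c u v ↦ by simp only [coordField_smul, real_inner_smul_right, smul_eq_mul])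

lemma coordForm_apply (y₀ : N) (s u v : E) :
    coordForm J y₀ s u v = inner ℝ
      (J ((extChartAt 𝓘(ℝ, E) y₀).symm s) (coordField y₀ u ((extChartAt 𝓘(ℝ, E) y₀).symm s)))
      (coordField y₀ v ((extChartAt 𝓘(ℝ, E) y₀).symm s)) := rfl

lemma IsKaehler.contDiffOn_coordForm (hJ : IsKaehler J) (y₀ : N) :
    ContDiffOn ℝ 1 (coordForm J y₀) (extChartAt 𝓘(ℝ, E) y₀).target := by
  rw [contDiffOn_clm_apply]
  intro u
  rw [contDiffOn_clm_apply]
  intro v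
  rw [← contMDiffOn_iff_contDiffOn]
  intro s hs
  exact (hJ.contMDiffAt_inner_coordField ((extChartAt 𝓘(ℝ, E) y₀).map_target hs) u v
    ).comp_contMDiffWithinAt s ((contMDiffOn_extChartAt_symm y₀) s hs)

lemma mfderiv_extChartAt_coordField {y₀ y : N} (hy : y ∈ (extChartAt 𝓘(ℝ, E) y₀).source) (u : E) :
    mfderiv 𝓘(ℝ, E) 𝓘(ℝ, E) (extChartAt 𝓘(ℝ, E) y₀) y (coordField y₀ u y) = u := by
  obtain ⟨e, he⟩ := isInvertible_mfderiv_extChartAt (I := 𝓘(ℝ, E)) hy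
  have h : coordField y₀ u y = e.symm u := by
    change (mfderiv 𝓘(ℝ, E) 𝓘(ℝ, E) (extChartAt 𝓘(ℝ, E) y₀) y).inverse u = _
    rw [← he, ContinuousLinearMap.inverse_equiv]
    rfl
  rw [← he, h]
  exact e.apply_symm_apply u

lemma coordField_mfderiv_extChartAt {y₀ y : N} (hy : y ∈ (extChartAt 𝓘(ℝ, E) y₀).source)
    (w : TangentSpace 𝓘(ℝ, E) y) :
    coordField (E := E) y₀ (mfderiv 𝓘(ℝ, E) 𝓘(ℝ, E) (extChartAt 𝓘(ℝ, E) y₀) y w) y = w :=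
  ContinuousLinearMap.IsInvertible.inverse_apply_self (isInvertible_mfderiv_extChartAt hy) w

/-- Translates the cyclic identity for the coordinate fields on `N` into the one for the
coefficients of the form in the chart. The functions correspond under the chart, whose differential
sends `coordField y₀ u` to `u`. -/
lemma IsKaehler.fderiv_coordForm (hJ : IsKaehler J) {y₀ y : N}
    (hy : y ∈ (extChartAt 𝓘(ℝ, E) y₀).source) (u v w : E) :
    fderiv ℝ (coordForm J y₀) (extChartAt 𝓘(ℝ, E) y₀ y) u v w = mvfderiv 𝓘(ℝ, E)
      (fun y ↦ (inner ℝ (J y (coordField y₀ v y)) (coordField y₀ w y) : ℝ)) y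
      (coordField y₀ u y) := by
  have hs := (extChartAt 𝓘(ℝ, E) y₀).map_source hy
  have hd : DifferentiableAt ℝ (coordForm J y₀) (extChartAt 𝓘(ℝ, E) y₀ y) :=
    ((hJ.contDiffOn_coordForm y₀).contDiffAt
      ((isOpen_extChartAt_target (I := 𝓘(ℝ, E)) y₀).mem_nhds hs)).differentiableAt one_ne_zero
  have h1 : fderiv ℝ (coordForm J y₀) (extChartAt 𝓘(ℝ, E) y₀ y) u v w =
      fderiv ℝ (fun t ↦ coordForm J y₀ t v w) (extChartAt 𝓘(ℝ, E) y₀ y) u := by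
    rw [fderiv_clm_apply (by fun_prop) (by fun_prop), fderiv_clm_apply (by fun_prop) (by fun_prop)]
    simp
  have hd' : DifferentiableAt ℝ (fun t ↦ coordForm J y₀ t v w) (extChartAt 𝓘(ℝ, E) y₀ y) := by
    fun_prop
  have h2 : (fun y ↦ (inner ℝ (J y (coordField y₀ v y)) (coordField y₀ w y) : ℝ)) =ᶠ[𝓝 y]
      (fun t ↦ coordForm J y₀ t v w) ∘ extChartAt 𝓘(ℝ, E) y₀ := by
    filter_upwards [extChartAt_source_mem_nhds' (I := 𝓘(ℝ, E)) hy] with z hz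
    rw [Function.comp_apply, coordForm_apply, (extChartAt 𝓘(ℝ, E) y₀).left_inv hz]
  have hκ : MDifferentiableAt 𝓘(ℝ, E) 𝓘(ℝ, E) (extChartAt 𝓘(ℝ, E) y₀) y :=
    mdifferentiableAt_extChartAt (by simpa using hy)
  have h3 := mfderiv_comp y hd'.mdifferentiableAt hκ
  have h4 := DFunLike.congr_fun (h2.mfderiv_eq.trans h3) (coordField y₀ u y)
  rw [h1]
  refine Eq.trans ?_ h4.symm
  refine Eq.trans ?_ (congrArg (mfderiv 𝓘(ℝ, E) 𝓘(ℝ, ℝ) (fun t ↦ coordForm J y₀ t v w)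
    (extChartAt 𝓘(ℝ, E) y₀ y)) (mfderiv_extChartAt_coordField hy u)).symm
  rw [mfderiv_eq_fderiv]
  rfl

/-- The pullback of the Kaehler form by a map from a vector space is closed. -/
lemma IsKaehler.cyclic_fderiv_eq_zero (hJ : IsKaehler J) {V : Type*} [NormedAddCommGroup V]
    [NormedSpace ℝ V] {φ : V → N} {p : V} (hφ : ContMDiffAt 𝓘(ℝ, V) 𝓘(ℝ, E) ∞ φ p)
    {Ω : V → V → V → ℝ} (hΩ : ∀ q a b, Ω q a b = inner ℝ
      (J (φ q) (mfderiv 𝓘(ℝ, V) 𝓘(ℝ, E) φ q a)) (mfderiv 𝓘(ℝ, V) 𝓘(ℝ, E) φ q b)) :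
    (∀ a b, DifferentiableAt ℝ (fun q ↦ Ω q a b) p) ∧
    ∀ a b c, fderiv ℝ (fun q ↦ Ω q b c) p a + fderiv ℝ (fun q ↦ Ω q c a) p b +
      fderiv ℝ (fun q ↦ Ω q a b) p c = 0 := by
  set y₀ := φ p with hy₀
  set G : V → E := extChartAt 𝓘(ℝ, E) y₀ ∘ φ with hGdef
  have hsrc : ∀ᶠ q in 𝓝 p, φ q ∈ (extChartAt 𝓘(ℝ, E) y₀).source :=
    hφ.continuousAt.eventually (extChartAt_source_mem_nhds (I := 𝓘(ℝ, E)) y₀)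
  have hφ1 : ContMDiffAt 𝓘(ℝ, V) 𝓘(ℝ, E) 1 φ p := hφ.of_le (by simp)
  have hG : ContDiffAt ℝ 2 G p := by
    rw [← contMDiffAt_iff_contDiffAt]
    exact (contMDiffAt_extChartAt (I := 𝓘(ℝ, E)) (x := y₀)).comp p (hφ.of_le ENat.LEInfty.out)
  -- The chart at `φ p` covers `φ q` only for `q` near `p`, so the coordinate expression is an
  -- equality of germs, which suffices for derivatives at `p`.
  have hev : ∀ a b, (fun q ↦ Ω q a b) =ᶠ[𝓝 p]
      fun q ↦ coordForm J y₀ (G q) (fderiv ℝ G q a) (fderiv ℝ G q b) := by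
    intro a b
    filter_upwards [hsrc, (contMDiffAt_iff_contMDiffAt_nhds (by simp)).1 hφ1] with q hq hφq
    have hd : ∀ c, coordField y₀ (fderiv ℝ G q c) (φ q) = mfderiv 𝓘(ℝ, V) 𝓘(ℝ, E) φ q c := by
      intro c
      rw [← mfderiv_eq_fderiv, hGdef, mfderiv_comp q
        (mdifferentiableAt_extChartAt (by simpa using hq)) (hφq.mdifferentiableAt one_ne_zero)]
      exact coordField_mfderiv_extChartAt hq _
    have hleft : (extChartAt 𝓘(ℝ, E) y₀).symm (G q) = φ q :=
      (extChartAt 𝓘(ℝ, E) y₀).left_inv hq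
    rw [hΩ, coordForm_apply, hleft, hd, hd]
  have hp := mem_extChartAt_source (I := 𝓘(ℝ, E)) y₀
  have hη : DifferentiableAt ℝ (coordForm J y₀) (G p) :=
    ((hJ.contDiffOn_coordForm y₀).contDiffAt
      ((isOpen_extChartAt_target (I := 𝓘(ℝ, E)) y₀).mem_nhds
        ((extChartAt 𝓘(ℝ, E) y₀).map_source hp))).differentiableAt one_ne_zero
  obtain ⟨h1, h2⟩ := cyclic_fderiv_pullback_eq_zero hG hη
    (fun u v ↦ by rw [coordForm_apply, coordForm_apply]; exact hJ.inner_map_skew _ _ _)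
    (fun u v w ↦ by
      have hc := fun u ↦ contMDiffAt_coordField (y₀ := y₀) hp u
      simp only [hGdef, Function.comp_apply]
      rw [hJ.fderiv_coordForm hp, hJ.fderiv_coordForm hp, hJ.fderiv_coordForm hp]
      exact hJ.cyclic_mvfderiv_eq_zero (hc u) (hc v) (hc w) (mlieBracket_coordField hp u v)
        (mlieBracket_coordField hp v w) (mlieBracket_coordField hp w u))
  refine ⟨fun a b ↦ (h1 a b).congr_of_eventuallyEq (hev a b), fun a b c ↦ ?_⟩
  rw [(hev b c).fderiv_eq, (hev c a).fderiv_eq, (hev a b).fderiv_eq]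
  exact h2 a b c

end

/-! ### Linear algebra of slant subspaces -/

section LinearAlgebra

lemma norm_starProjection_of_angleToSubspace {V : Type*} [NormedAddCommGroup V]
    [InnerProductSpace ℝ V] {v : V} {W : Submodule ℝ V} [W.HasOrthogonalProjection] {θ : ℝ}
    (h : angleToSubspace v W = θ) : ‖W.starProjection v‖ = Real.cos θ * ‖v‖ := by
  have h1 : inner ℝ v (W.starProjection v) = ‖W.starProjection v‖ ^ 2 := by
    rw [← real_inner_self_eq_norm_sq, ← sub_eq_zero, ← inner_sub_left]
    exact W.starProjection_inner_eq_zero v _ (W.starProjection_apply_mem v)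
  rw [← h, angleToSubspace]
  by_cases h0 : W.starProjection v = 0
  -- By convention the angle with the zero vector is `π / 2`, so its cosine vanishes as well.
  · simp [h0]
  · have h2 := InnerProductGeometry.cos_angle_mul_norm_mul_norm v (W.starProjection v)
    rw [h1] at h2
    have h3 : ‖W.starProjection v‖ ≠ 0 := norm_ne_zero_iff.2 h0
    apply mul_right_cancel₀ h3
    linarith

lemma inner_eq_zero_of_angleToSubspace {V : Type*} [NormedAddCommGroup V]
    [InnerProductSpace ℝ V] {v w : V} {W : Submodule ℝ V} [W.HasOrthogonalProjection]
    (h : angleToSubspace v W = Real.pi / 2) (hw : w ∈ W) : inner ℝ v w = 0 := by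
  have h1 := norm_starProjection_of_angleToSubspace h
  rw [Real.cos_pi_div_two, zero_mul, norm_eq_zero] at h1
  have := W.starProjection_inner_eq_zero v w hw
  rwa [h1, sub_zero] at this

/-- Two homothetic embeddings of the same space as slant subspaces with the same slant angle
`θ ≠ π / 2`, inducing the same skew form, have comparable homothety factors. -/
lemma le_of_slant_of_inner_eq {T V₁ V₂ : Type*} [AddCommGroup T] [Module ℝ T]
    [NormedAddCommGroup V₁] [InnerProductSpace ℝ V₁] [NormedAddCommGroup V₂]
    [InnerProductSpace ℝ V₂] {d₁ : T →ₗ[ℝ] V₁} {d₂ : T →ₗ[ℝ] V₂} {J₁ : V₁ → V₁} {J₂ : V₂ → V₂}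
    {S₁ : Submodule ℝ V₁} {S₂ : Submodule ℝ V₂} [S₁.HasOrthogonalProjection]
    [S₂.HasOrthogonalProjection] (hS₁ : ∀ u, u ∈ S₁ ↔ ∃ z, d₁ z = u)
    (hS₂ : ∀ u, u ∈ S₂ ↔ ∃ z, d₂ z = u) {q : T → ℝ} {c₁ c₂ θ : ℝ} (hc₁ : 0 < c₁) (hc₂ : 0 < c₂)
    (hd₁ : ∀ z, ‖d₁ z‖ ^ 2 = c₁ ^ 2 * q z) (hd₂ : ∀ z, ‖d₂ z‖ ^ 2 = c₂ ^ 2 * q z)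
    (hJ₁ : ∀ v, ‖J₁ v‖ = ‖v‖) (hJ₂ : ∀ v, ‖J₂ v‖ = ‖v‖)
    (hθ₁ : ∀ u ∈ S₁, u ≠ 0 → angleToSubspace (J₁ u) S₁ = θ)
    (hθ₂ : ∀ u ∈ S₂, u ≠ 0 → angleToSubspace (J₂ u) S₂ = θ)
    (hform : ∀ z w, (inner ℝ (J₁ (d₁ z)) (d₁ w) : ℝ) = inner ℝ (J₂ (d₂ z)) (d₂ w))
    {z : T} (hz : 0 < q z) (hθ : Real.cos θ ≠ 0) : c₁ ≤ c₂ := by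
  have n₁ : 0 < ‖d₁ z‖ ^ 2 := by rw [hd₁]; positivity
  have n₂ : 0 < ‖d₂ z‖ ^ 2 := by rw [hd₂]; positivity
  have p₁ := norm_starProjection_of_angleToSubspace
    (hθ₁ (d₁ z) ((hS₁ _).2 ⟨z, rfl⟩) (by rintro h; simp [h] at n₁))
  have p₂ := norm_starProjection_of_angleToSubspace
    (hθ₂ (d₂ z) ((hS₂ _).2 ⟨z, rfl⟩) (by rintro h; simp [h] at n₂))
  rw [hJ₁] at p₁
  rw [hJ₂] at p₂
  -- With `d₁ w` the projection of `J₁ (d₁ z)`, the common form at `(z, w)` equals `‖d₁ w‖² = cos² θ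
  -- · c₁² q z`. In the second space Cauchy-Schwarz bounds it by `cos² θ · c₂² q z`, because `q w =
  -- cos² θ · q z`. Hence `c₁² ≤ c₂²`.
  obtain ⟨w, hw⟩ := (hS₁ _).1 (S₁.starProjection_apply_mem (J₁ (d₁ z)))
  have i₁ : (inner ℝ (J₁ (d₁ z)) (d₁ w) : ℝ) = ‖d₁ w‖ ^ 2 := by
    rw [← real_inner_self_eq_norm_sq, ← sub_eq_zero, ← inner_sub_left]
    nth_rewrite 1 [hw]
    exact S₁.starProjection_inner_eq_zero _ _ ((hS₁ _).2 ⟨w, rfl⟩)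
  have i₂ : (inner ℝ (J₂ (d₂ z)) (d₂ w) : ℝ) ≤ ‖S₂.starProjection (J₂ (d₂ z))‖ * ‖d₂ w‖ := by
    have := S₂.starProjection_inner_eq_zero (J₂ (d₂ z)) (d₂ w) ((hS₂ _).2 ⟨w, rfl⟩)
    rw [inner_sub_left, sub_eq_zero] at this
    rw [this]
    exact real_inner_le_norm _ _
  have e₁ : ‖d₁ w‖ ^ 2 = Real.cos θ ^ 2 * (c₁ ^ 2 * q z) := by
    rw [hw, p₁, mul_pow, hd₁]
  have qw : q w = Real.cos θ ^ 2 * q z := by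
    have := hd₁ w
    rw [e₁] at this
    apply mul_left_cancel₀ (pow_ne_zero 2 hc₁.ne')
    linarith
  -- The squares are compared first, so that the sign of `cos θ` need not be discussed.
  have e₂ : (‖S₂.starProjection (J₂ (d₂ z))‖ * ‖d₂ w‖) ^ 2 =
      (Real.cos θ ^ 2 * (c₂ ^ 2 * q z)) ^ 2 := by
    rw [mul_pow, p₂, mul_pow, hd₂, hd₂, qw]; ring
  have pos : 0 < Real.cos θ ^ 2 := by positivity
  have e₃ : ‖S₂.starProjection (J₂ (d₂ z))‖ * ‖d₂ w‖ = Real.cos θ ^ 2 * (c₂ ^ 2 * q z) :=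
    (pow_left_inj₀ (by positivity) (by positivity) two_ne_zero).1 e₂
  rw [← hform, i₁, e₁, e₃] at i₂
  have := le_of_mul_le_mul_right (le_of_mul_le_mul_left i₂ pos) hz
  exact (pow_le_pow_iff_left₀ hc₁.le hc₂.le two_ne_zero).1 this

end LinearAlgebra

/-! ### Functoriality of the pullback form -/

section

set_option linter.unusedSectionVars false

variable {E : Type*} [NormedAddCommGroup E] [NormedSpace ℝ E] [FiniteDimensional ℝ E]
  {N : Type*} [TopologicalSpace N] [ChartedSpace E N] [IsManifold 𝓘(ℝ, E) ∞ N]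
  [RiemannianBundle (fun x : N ↦ TangentSpace 𝓘(ℝ, E) x)]
  [IsContMDiffRiemannianBundle 𝓘(ℝ, E) ∞ E (fun x : N ↦ TangentSpace 𝓘(ℝ, E) x)]
  (J : ∀ x : N, TangentSpace 𝓘(ℝ, E) x →L[ℝ] TangentSpace 𝓘(ℝ, E) x)
  {F : Type*} [NormedAddCommGroup F] [NormedSpace ℝ F]
  {H : Type*} [TopologicalSpace H] {I : ModelWithCorners ℝ F H}
  {M : Type*} [TopologicalSpace M] [ChartedSpace H M]
  {F' : Type*} [NormedAddCommGroup F'] [NormedSpace ℝ F']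
  {H' : Type*} [TopologicalSpace H'] {I' : ModelWithCorners ℝ F' H'}
  {M' : Type*} [TopologicalSpace M'] [ChartedSpace H' M']

/-- The pullback of the form `⟨J ·, ·⟩` by `φ : M → N`. -/
def pullbackForm (I : ModelWithCorners ℝ F H) (φ : M → N) (p : M) (u v : TangentSpace I p) : ℝ :=
  inner ℝ (J (φ p) (mfderiv I 𝓘(ℝ, E) φ p u)) (mfderiv I 𝓘(ℝ, E) φ p v)

lemma pullbackForm_comp {φ : M → N} {h : M' → M} {p : M'}
    (hφ : MDifferentiableAt I 𝓘(ℝ, E) φ (h p)) (hh : MDifferentiableAt I' I h p)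
    (u v : TangentSpace I' p) :
    pullbackForm J I' (φ ∘ h) p u v =
      pullbackForm J I φ (h p) (mfderiv I' I h p u) (mfderiv I' I h p v) := by
  rw [pullbackForm, mfderiv_comp p hφ hh]
  rfl

lemma pullbackForm_congr {φ φ' : M → N} {p : M} (h : φ =ᶠ[𝓝 p] φ') (u v : TangentSpace I p) :
    pullbackForm J I φ p u v = pullbackForm J I φ' p u v := by
  -- The tangent spaces at `φ p` and `φ' p` are different types, but both unfold to `E`; with the
  -- vectors taken in `E`, the equality of base points can be eliminated.
  have key : ∀ (y y' : N) (_ : y = y') (a b : E),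
      (inner ℝ (J y (a : TangentSpace 𝓘(ℝ, E) y)) (b : TangentSpace 𝓘(ℝ, E) y) : ℝ) =
      inner ℝ (J y' (a : TangentSpace 𝓘(ℝ, E) y')) (b : TangentSpace 𝓘(ℝ, E) y') := by
    rintro y _ rfl a b; rfl
  have h1 := h.mfderiv_eq (I := I) (I' := 𝓘(ℝ, E))
  rw [pullbackForm, h1]
  exact key _ _ h.eq_of_nhds _ _

end

/-! ### The vertical part of the form is constant along `M₁` -/

section

set_option linter.unusedSectionVars false

variable {E : Type*} [NormedAddCommGroup E] [NormedSpace ℝ E] [FiniteDimensional ℝ E]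
  {N : Type*} [TopologicalSpace N] [ChartedSpace E N] [IsManifold 𝓘(ℝ, E) ∞ N]
  [RiemannianBundle (fun x : N ↦ TangentSpace 𝓘(ℝ, E) x)]
  [IsContMDiffRiemannianBundle 𝓘(ℝ, E) ∞ E (fun x : N ↦ TangentSpace 𝓘(ℝ, E) x)]
  {J : ∀ x : N, TangentSpace 𝓘(ℝ, E) x →L[ℝ] TangentSpace 𝓘(ℝ, E) x}
  {E₁ : Type*} [NormedAddCommGroup E₁] [NormedSpace ℝ E₁]
  {F₂ : Type*} [NormedAddCommGroup F₂] [NormedSpace ℝ F₂]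

/-- The mixed parts of a closed form vanishing, its vertical part is constant in the horizontal
direction: version on a product of vector spaces. -/
lemma IsKaehler.hasFDerivAt_pullbackForm_prod (hJ : IsKaehler J) {φ : E₁ × F₂ → N}
    {s : E₁} {t : F₂} (hφ : ContMDiffAt 𝓘(ℝ, E₁ × F₂) 𝓘(ℝ, E) ∞ φ (s, t))
    (horth : ∀ᶠ q in 𝓝 (s, t), ∀ (X : E₁) (Z : F₂),
      pullbackForm J 𝓘(ℝ, E₁ × F₂) φ q ((X, 0) : E₁ × F₂) ((0, Z) : E₁ × F₂) = 0) (Z W : F₂) :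
    HasFDerivAt (fun s' ↦ pullbackForm J 𝓘(ℝ, F₂) (fun t' ↦ φ (s', t')) t Z W)
      (0 : E₁ →L[ℝ] ℝ) s := by
  obtain ⟨hd, hc⟩ := hJ.cyclic_fderiv_eq_zero hφ
    (Ω := fun q a b ↦ pullbackForm J 𝓘(ℝ, E₁ × F₂) φ q a b) (fun q a b ↦ rfl)
  have hzero : ∀ X Z, fderiv ℝ (fun q ↦ pullbackForm J 𝓘(ℝ, E₁ × F₂) φ q
      ((X, 0) : E₁ × F₂) ((0, Z) : E₁ × F₂)) (s, t) = 0 := by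
    intro X Z
    have : (fun q ↦ pullbackForm J 𝓘(ℝ, E₁ × F₂) φ q
      ((X, 0) : E₁ × F₂) ((0, Z) : E₁ × F₂)) =ᶠ[𝓝 (s, t)] fun _ ↦ 0 := by
      filter_upwards [horth] with q hq using hq X Z
    rw [this.fderiv_eq, fderiv_fun_const]; rfl
  have hzero' : ∀ X Z, fderiv ℝ (fun q ↦ pullbackForm J 𝓘(ℝ, E₁ × F₂) φ q
      ((0, Z) : E₁ × F₂) ((X, 0) : E₁ × F₂)) (s, t) = 0 := by
    intro X Z
    have : (fun q ↦ pullbackForm J 𝓘(ℝ, E₁ × F₂) φ q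
      ((0, Z) : E₁ × F₂) ((X, 0) : E₁ × F₂)) =ᶠ[𝓝 (s, t)] fun _ ↦ 0 := by
      filter_upwards [horth] with q hq
      exact (hJ.inner_map_skew _ _ _).trans (neg_eq_zero.2 (hq X Z))
    rw [this.fderiv_eq, fderiv_fun_const]; rfl
  have hX : ∀ X : E₁, fderiv ℝ (fun q ↦ pullbackForm J 𝓘(ℝ, E₁ × F₂) φ q
      ((0, Z) : E₁ × F₂) ((0, W) : E₁ × F₂)) (s, t) (X, 0) = 0 := by
    intro X
    -- The other two terms of the cyclic identity differentiate mixed components, which vanish near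
    -- `(s, t)`.
    have := hc (X, 0) (0, Z) (0, W)
    rw [hzero, hzero'] at this
    simpa using this
  have hι : HasFDerivAt (fun s' : E₁ ↦ (s', t)) (ContinuousLinearMap.inl ℝ E₁ F₂) s :=
    hasFDerivAt_prodMk_left s t
  have hcomp := HasFDerivAt.comp (g := fun q ↦ pullbackForm J 𝓘(ℝ, E₁ × F₂) φ q
      ((0, Z) : E₁ × F₂) ((0, W) : E₁ × F₂)) s (hd (0, Z) (0, W)).hasFDerivAt hι
  have h0 : (fderiv ℝ (fun q ↦ pullbackForm J 𝓘(ℝ, E₁ × F₂) φ q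
      ((0, Z) : E₁ × F₂) ((0, W) : E₁ × F₂)) (s, t)).comp (ContinuousLinearMap.inl ℝ E₁ F₂) = 0 := by
    ext X
    exact hX X
  rw [h0] at hcomp
  refine hcomp.congr_of_eventuallyEq ?_
  have hφ1 : ContMDiffAt 𝓘(ℝ, E₁ × F₂) 𝓘(ℝ, E) 1 φ (s, t) := hφ.of_le (by simp)
  have hev := hι.continuousAt.eventually ((contMDiffAt_iff_contMDiffAt_nhds (by simp)).1 hφ1)
  -- It remains to recognise the component along `(0, Z)`, `(0, W)` as the form pulled back by the
  -- slice `φ (s', ·)`.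
  filter_upwards [hev] with s' hs'
  have hκ : HasFDerivAt (fun t' : F₂ ↦ (s', t')) (ContinuousLinearMap.inr ℝ E₁ F₂) t :=
    hasFDerivAt_prodMk_right s' t
  have := pullbackForm_comp J (φ := φ) (h := fun t' : F₂ ↦ (s', t')) (p := t)
    (I := 𝓘(ℝ, E₁ × F₂)) (I' := 𝓘(ℝ, F₂))
    (hs'.mdifferentiableAt one_ne_zero) hκ.differentiableAt.mdifferentiableAt Z W
  rw [mfderiv_eq_fderiv, hκ.fderiv] at this
  exact this

variable
  {M₁ : Type*} [TopologicalSpace M₁] [ChartedSpace E₁ M₁] [IsManifold 𝓘(ℝ, E₁) ∞ M₁]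
  {B : Type*} [TopologicalSpace B] [ChartedSpace F₂ B] [IsManifold 𝓘(ℝ, F₂) ∞ B]

/-- If the mixed part of the pullback of the Kaehler form to `M₁ × B` vanishes, then its part along
`B` does not depend on the point of `M₁`. -/
lemma IsKaehler.pullbackForm_eq_of_mixed_eq_zero (hJ : IsKaehler J) [PreconnectedSpace M₁]
    {ψ : M₁ → B → N}
    (hψ : ContMDiff (𝓘(ℝ, E₁).prod 𝓘(ℝ, F₂)) 𝓘(ℝ, E) ∞ (fun p : M₁ × B ↦ ψ p.1 p.2))
    (horth : ∀ x b (X : TangentSpace 𝓘(ℝ, E₁) x) (Z : TangentSpace 𝓘(ℝ, F₂) b),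
      (inner ℝ (J (ψ x b) (mfderiv 𝓘(ℝ, E₁) 𝓘(ℝ, E) (fun x ↦ ψ x b) x X))
        (mfderiv 𝓘(ℝ, F₂) 𝓘(ℝ, E) (ψ x) b Z) : ℝ) = 0)
    (b : B) (Z W : TangentSpace 𝓘(ℝ, F₂) b) (x x' : M₁) :
    pullbackForm J 𝓘(ℝ, F₂) (ψ x) b Z W = pullbackForm J 𝓘(ℝ, F₂) (ψ x') b Z W := by
  suffices h : IsLocallyConstant fun x ↦ pullbackForm J 𝓘(ℝ, F₂) (ψ x) b Z W from
    h.apply_eq_of_preconnectedSpace x x'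
  rw [IsLocallyConstant.iff_eventually_eq]
  intro x₀
  set e := extChartAt 𝓘(ℝ, E₁) x₀
  set k := extChartAt 𝓘(ℝ, F₂) b
  set φ : E₁ × F₂ → N := fun q ↦ ψ (e.symm q.1) (k.symm q.2) with hφdef
  have hb : k b ∈ k.target := mem_extChartAt_target b
  have he_open : IsOpen e.target := isOpen_extChartAt_target x₀
  have hk_open : IsOpen k.target := isOpen_extChartAt_target b
  have he : ∀ s ∈ e.target, ContMDiffAt 𝓘(ℝ, E₁) 𝓘(ℝ, E₁) ∞ e.symm s := fun s hs ↦
    (contMDiffOn_extChartAt_symm x₀).contMDiffAt (he_open.mem_nhds hs)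
  have hk : ∀ t ∈ k.target, ContMDiffAt 𝓘(ℝ, F₂) 𝓘(ℝ, F₂) ∞ k.symm t := fun t ht ↦
    (contMDiffOn_extChartAt_symm b).contMDiffAt (hk_open.mem_nhds ht)
  have hφ : ∀ q ∈ e.target ×ˢ k.target, ContMDiffAt 𝓘(ℝ, E₁ × F₂) 𝓘(ℝ, E) ∞ φ q := by
    rintro ⟨s, t⟩ ⟨hs, ht⟩
    have h1 : ContMDiffAt 𝓘(ℝ, E₁ × F₂) 𝓘(ℝ, E₁) ∞ (fun q : E₁ × F₂ ↦ e.symm q.1) (s, t) :=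
      (he s hs).comp (s, t) contDiffAt_fst.contMDiffAt
    have h2 : ContMDiffAt 𝓘(ℝ, E₁ × F₂) 𝓘(ℝ, F₂) ∞ (fun q : E₁ × F₂ ↦ k.symm q.2) (s, t) :=
      (hk t ht).comp (s, t) contDiffAt_snd.contMDiffAt
    exact (hψ _).comp (s, t) (h1.prodMk h2)
  have hψ₁ : ∀ x b, MDifferentiableAt 𝓘(ℝ, E₁) 𝓘(ℝ, E) (fun x ↦ ψ x b) x := fun x b ↦
    ((hψ (x, b)).comp x (contMDiffAt_id.prodMk contMDiffAt_const)).mdifferentiableAt (by simp)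
  have hψ₂ : ∀ x b, MDifferentiableAt 𝓘(ℝ, F₂) 𝓘(ℝ, E) (ψ x) b := fun x b ↦
    ((hψ (x, b)).comp b (contMDiffAt_const.prodMk contMDiffAt_id)).mdifferentiableAt (by simp)
  have hmixed : ∀ q ∈ e.target ×ˢ k.target, ∀ (X : E₁) (Z : F₂),
      pullbackForm J 𝓘(ℝ, E₁ × F₂) φ q ((X, 0) : E₁ × F₂) ((0, Z) : E₁ × F₂) = 0 := by
    rintro ⟨s, t⟩ hq X Z
    have hd := (hφ _ hq).mdifferentiableAt (by simp)
    have hι : HasFDerivAt (fun s' : E₁ ↦ (s', t)) (ContinuousLinearMap.inl ℝ E₁ F₂) s :=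
      hasFDerivAt_prodMk_left s t
    have hκ : HasFDerivAt (fun t' : F₂ ↦ (s, t')) (ContinuousLinearMap.inr ℝ E₁ F₂) t :=
      hasFDerivAt_prodMk_right s t
    have h1 : mfderiv 𝓘(ℝ, E₁ × F₂) 𝓘(ℝ, E) φ (s, t) ((X, 0) : E₁ × F₂) =
        mfderiv 𝓘(ℝ, E₁) 𝓘(ℝ, E) (fun x ↦ ψ x (k.symm t)) (e.symm s)
          (mfderiv 𝓘(ℝ, E₁) 𝓘(ℝ, E₁) e.symm s X) := by
      have a1 := mfderiv_comp s (f := fun s' : E₁ ↦ (s', t)) (g := φ) (I := 𝓘(ℝ, E₁))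
        (I' := 𝓘(ℝ, E₁ × F₂)) (I'' := 𝓘(ℝ, E)) hd hι.differentiableAt.mdifferentiableAt
      have a2 := mfderiv_comp s (f := e.symm) (g := fun x ↦ ψ x (k.symm t)) (I := 𝓘(ℝ, E₁))
        (I' := 𝓘(ℝ, E₁)) (I'' := 𝓘(ℝ, E)) (hψ₁ _ _) ((he s hq.1).mdifferentiableAt (by simp))
      rw [mfderiv_eq_fderiv, hι.fderiv] at a1
      exact DFunLike.congr_fun (a1.symm.trans a2) X
    have h2 : mfderiv 𝓘(ℝ, E₁ × F₂) 𝓘(ℝ, E) φ (s, t) ((0, Z) : E₁ × F₂) =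
        mfderiv 𝓘(ℝ, F₂) 𝓘(ℝ, E) (ψ (e.symm s)) (k.symm t)
          (mfderiv 𝓘(ℝ, F₂) 𝓘(ℝ, F₂) k.symm t Z) := by
      have a1 := mfderiv_comp t (f := fun t' : F₂ ↦ (s, t')) (g := φ) (I := 𝓘(ℝ, F₂))
        (I' := 𝓘(ℝ, E₁ × F₂)) (I'' := 𝓘(ℝ, E)) hd hκ.differentiableAt.mdifferentiableAt
      have a2 := mfderiv_comp t (f := k.symm) (g := ψ (e.symm s)) (I := 𝓘(ℝ, F₂))
        (I' := 𝓘(ℝ, F₂)) (I'' := 𝓘(ℝ, E)) (hψ₂ _ _) ((hk t hq.2).mdifferentiableAt (by simp))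
      rw [mfderiv_eq_fderiv, hκ.fderiv] at a1
      exact DFunLike.congr_fun (a1.symm.trans a2) Z
    change (inner ℝ (J (φ (s, t)) (mfderiv 𝓘(ℝ, E₁ × F₂) 𝓘(ℝ, E) φ (s, t) ((X, 0) : E₁ × F₂)))
      (mfderiv 𝓘(ℝ, E₁ × F₂) 𝓘(ℝ, E) φ (s, t) ((0, Z) : E₁ × F₂)) : ℝ) = 0
    rw [h1, h2]
    exact horth _ _ _ _
  -- The coordinates of `Z` and `W` depend only on `b`, so they stay fixed while the point of `M₁`
  -- moves.
  set Z' : F₂ := mfderiv 𝓘(ℝ, F₂) 𝓘(ℝ, F₂) k b Z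
  set W' : F₂ := mfderiv 𝓘(ℝ, F₂) 𝓘(ℝ, F₂) k b W
  have hderiv : ∀ s ∈ e.target, HasFDerivAt
      (fun s ↦ pullbackForm J 𝓘(ℝ, F₂) (fun t ↦ φ (s, t)) (k b) Z' W') (0 : E₁ →L[ℝ] ℝ) s := fun s hs ↦
    hJ.hasFDerivAt_pullbackForm_prod (hφ _ ⟨hs, hb⟩)
      (by
        filter_upwards [(he_open.prod hk_open).mem_nhds ⟨hs, hb⟩] with q hq using hmixed q hq) Z' W'
  have hchart : ∀ s ∈ e.target, pullbackForm J 𝓘(ℝ, F₂) (ψ (e.symm s)) b Z W =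
      pullbackForm J 𝓘(ℝ, F₂) (fun t ↦ φ (s, t)) (k b) Z' W' := by
    intro s hs
    have h1 : ψ (e.symm s) =ᶠ[𝓝 b] (fun t ↦ φ (s, t)) ∘ k := by
      filter_upwards [extChartAt_source_mem_nhds (I := 𝓘(ℝ, F₂)) b] with b' hb'
      simp only [hφdef, Function.comp_apply, k, PartialEquiv.left_inv _ hb']
    have hd : MDifferentiableAt 𝓘(ℝ, F₂) 𝓘(ℝ, E) (fun t ↦ φ (s, t)) (k b) :=
      ((hψ₂ (e.symm s) _).comp (k b) ((hk _ hb).mdifferentiableAt (by simp)))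
    rw [pullbackForm_congr J h1]
    exact pullbackForm_comp J hd (mdifferentiableAt_extChartAt (mem_chart_source _ _)) Z W
  -- A ball inside the chart target is convex, so a vanishing derivative forces constancy on it.
  obtain ⟨r, hr, hball⟩ := Metric.isOpen_iff.1 he_open (e x₀) (mem_extChartAt_target x₀)
  have hconst : ∀ s ∈ Metric.ball (e x₀) r,
      pullbackForm J 𝓘(ℝ, F₂) (fun t ↦ φ (s, t)) (k b) Z' W' =
      pullbackForm J 𝓘(ℝ, F₂) (fun t ↦ φ (e x₀, t)) (k b) Z' W' := fun s hs ↦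
    (convex_ball (e x₀) r).is_const_of_fderivWithin_eq_zero (𝕜 := ℝ)
      (fun s hs ↦ (hderiv s (hball hs)).differentiableAt.differentiableWithinAt)
      (fun s hs ↦ by
        rw [fderivWithin_of_isOpen Metric.isOpen_ball hs, (hderiv s (hball hs)).fderiv])
      hs (Metric.mem_ball_self hr)
  filter_upwards [extChartAt_source_mem_nhds (I := 𝓘(ℝ, E₁)) x₀,
    (continuousAt_extChartAt (I := 𝓘(ℝ, E₁)) x₀).eventually (Metric.ball_mem_nhds _ hr)] with x hx hx'
  have h1 := hchart (e x) (hball hx')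
  have h2 := hchart (e x₀) (mem_extChartAt_target x₀)
  rw [e.left_inv hx] at h1
  rw [e.left_inv (mem_extChartAt_source x₀)] at h2
  rw [h1, h2]
  exact hconst _ hx'

end

/-! ### Rescaling a Riemannian metric -/

section Metric

variable {F : Type*} [NormedAddCommGroup F] [NormedSpace ℝ F]
  {H : Type*} [TopologicalSpace H] {I : ModelWithCorners ℝ F H}
  {M : Type*} [TopologicalSpace M] [ChartedSpace H M] [IsManifold I ∞ M]

set_option synthInstance.maxHeartbeats 400000 in
/-- The homothetic metric `c² g`. -/
def homotheticMetric (g : ContMDiffRiemannianMetric I ∞ F (fun x : M ↦ TangentSpace I x))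
    (c : ℝ) (hc : 0 < c) : ContMDiffRiemannianMetric I ∞ F (fun x : M ↦ TangentSpace I x) where
  inner x := c ^ 2 • g.inner x
  symm x v w := by
    change c ^ 2 * g.inner x v w = c ^ 2 * g.inner x w v
    rw [g.symm]
  pos x v hv := by
    change 0 < c ^ 2 * g.inner x v v
    have := g.pos x v hv
    positivity
  isVonNBounded x := by
    -- The unit ball of `c² g` is contained in the image of the unit ball of `g` under
    -- multiplication by `c⁻¹`.
    refine ((g.isVonNBounded x).image
      (c⁻¹ • ContinuousLinearMap.id ℝ (TangentSpace I x))).subset ?_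
    intro v hv
    change c ^ 2 * g.inner x v v < 1 at hv
    refine ⟨c • v, ?_, ?_⟩
    · change g.inner x (c • v) (c • v) < 1
      simp only [map_smul, FunLike.coe_smul, Pi.smul_apply, smul_eq_mul]
      linarith
    · change c⁻¹ • c • v = v
      rw [smul_smul, inv_mul_cancel₀ hc.ne', one_smul]
  contMDiff := g.contMDiff.const_smul_section (a := c ^ 2)

lemma homotheticMetric_inner (g : ContMDiffRiemannianMetric I ∞ F (fun x : M ↦ TangentSpace I x))
    {c : ℝ} (hc : 0 < c) (x : M) (v w : TangentSpace I x) :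
    (homotheticMetric g c hc).inner x v w = c ^ 2 * g.inner x v w := rfl

end Metric

/-! ### Leaves of the warped product -/

section Leaves

set_option linter.unusedSectionVars false

variable {E : Type*} [NormedAddCommGroup E] [NormedSpace ℝ E] [FiniteDimensional ℝ E]
  {N : Type*} [TopologicalSpace N] [ChartedSpace E N] [IsManifold 𝓘(ℝ, E) ∞ N]
  [RiemannianBundle (fun x : N ↦ TangentSpace 𝓘(ℝ, E) x)]
  [IsContMDiffRiemannianBundle 𝓘(ℝ, E) ∞ E (fun x : N ↦ TangentSpace 𝓘(ℝ, E) x)]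
  {J : ∀ x : N, TangentSpace 𝓘(ℝ, E) x →L[ℝ] TangentSpace 𝓘(ℝ, E) x}
  {E₁ : Type*} [NormedAddCommGroup E₁] [NormedSpace ℝ E₁]
  {M₁ : Type*} [TopologicalSpace M₁] [ChartedSpace E₁ M₁] [IsManifold 𝓘(ℝ, E₁) ∞ M₁]
  {F₁ : Type*} [NormedAddCommGroup F₁] [NormedSpace ℝ F₁]
  {A : Type*} [TopologicalSpace A] [ChartedSpace F₁ A] [IsManifold 𝓘(ℝ, F₁) ∞ A]
  {F₂ : Type*} [NormedAddCommGroup F₂] [NormedSpace ℝ F₂]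
  {B : Type*} [TopologicalSpace B] [ChartedSpace F₂ B] [IsManifold 𝓘(ℝ, F₂) ∞ B]
  {χ : M₁ × (A × B) → N}

lemma mdifferentiableAt_inclFirst (x : M₁) (a : A) (b : B) :
    MDifferentiableAt 𝓘(ℝ, E₁) (𝓘(ℝ, E₁).prod (𝓘(ℝ, F₁).prod 𝓘(ℝ, F₂)))
      (fun x : M₁ ↦ (x, (a, b))) x :=
  mdifferentiableAt_id.prodMk mdifferentiableAt_const

lemma mdifferentiableAt_inclThird (x : M₁) (a : A) (b : B) :
    MDifferentiableAt 𝓘(ℝ, F₂) (𝓘(ℝ, E₁).prod (𝓘(ℝ, F₁).prod 𝓘(ℝ, F₂)))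
      (fun b : B ↦ (x, (a, b))) b :=
  mdifferentiableAt_const.prodMk (mdifferentiableAt_const.prodMk mdifferentiableAt_id)

variable (hχ : ContMDiff (𝓘(ℝ, E₁).prod (𝓘(ℝ, F₁).prod 𝓘(ℝ, F₂))) 𝓘(ℝ, E) ∞ χ)
include hχ

lemma mfderiv_leafFirst (x : M₁) (a : A) (b : B) :
    mfderiv 𝓘(ℝ, E₁) 𝓘(ℝ, E) (fun x ↦ χ (x, (a, b))) x =
      (mfderiv (𝓘(ℝ, E₁).prod (𝓘(ℝ, F₁).prod 𝓘(ℝ, F₂))) 𝓘(ℝ, E) χ (x, (a, b))).comp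
        (mfderiv 𝓘(ℝ, E₁) (𝓘(ℝ, E₁).prod (𝓘(ℝ, F₁).prod 𝓘(ℝ, F₂)))
          (fun x : M₁ ↦ (x, (a, b))) x) :=
  mfderiv_comp x ((hχ _).mdifferentiableAt (by simp)) (mdifferentiableAt_inclFirst x a b)

lemma mfderiv_leafThird (x : M₁) (a : A) (b : B) :
    mfderiv 𝓘(ℝ, F₂) 𝓘(ℝ, E) (fun b ↦ χ (x, (a, b))) b =
      (mfderiv (𝓘(ℝ, E₁).prod (𝓘(ℝ, F₁).prod 𝓘(ℝ, F₂))) 𝓘(ℝ, E) χ (x, (a, b))).comp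
        (mfderiv 𝓘(ℝ, F₂) (𝓘(ℝ, E₁).prod (𝓘(ℝ, F₁).prod 𝓘(ℝ, F₂)))
          (fun b : B ↦ (x, (a, b))) b) :=
  mfderiv_comp b ((hχ _).mdifferentiableAt (by simp)) (mdifferentiableAt_inclThird x a b)

lemma mem_push_tangentFirst (x : M₁) (a : A) (b : B) (X : TangentSpace 𝓘(ℝ, E₁) x) :
    mfderiv 𝓘(ℝ, E₁) 𝓘(ℝ, E) (fun x ↦ χ (x, (a, b))) x X ∈
      push (E := E) χ (tangentFirst E₁ F₁ F₂) (x, (a, b)) := by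
  rw [mfderiv_leafFirst hχ]
  exact ⟨_, ⟨X, rfl⟩, rfl⟩

lemma mem_push_tangentThird_iff (x : M₁) (a : A) (b : B) (u : TangentSpace 𝓘(ℝ, E) (χ (x, (a, b)))) :
    u ∈ push (E := E) χ (tangentThird E₁ F₁ F₂) (x, (a, b)) ↔
      ∃ Z, mfderiv 𝓘(ℝ, F₂) 𝓘(ℝ, E) (fun b ↦ χ (x, (a, b))) b Z = u := by
  rw [mfderiv_leafThird hχ]
  constructor
  · rintro ⟨_, ⟨Z, rfl⟩, rfl⟩
    exact ⟨Z, rfl⟩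
  · rintro ⟨Z, rfl⟩
    exact ⟨_, ⟨Z, rfl⟩, rfl⟩

omit hχ

/-- The first projection is constant on the leaf, so only the warped term survives. The leaves over
different `x` are therefore homothetic, with factor `f x`. -/
lemma warpedMetric_inclThird
    (g₁ : ContMDiffRiemannianMetric 𝓘(ℝ, E₁) ∞ E₁ (fun x : M₁ ↦ TangentSpace 𝓘(ℝ, E₁) x))
    (g₂ : ContMDiffRiemannianMetric (𝓘(ℝ, F₁).prod 𝓘(ℝ, F₂)) ∞ (F₁ × F₂)
      (fun y : A × B ↦ TangentSpace (𝓘(ℝ, F₁).prod 𝓘(ℝ, F₂)) y))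
    (f : M₁ → ℝ) (x : M₁) (a : A) (b : B) (Z W : TangentSpace 𝓘(ℝ, F₂) b) :
    warpedMetric g₁ f g₂ (x, (a, b))
      (mfderiv 𝓘(ℝ, F₂) (𝓘(ℝ, E₁).prod (𝓘(ℝ, F₁).prod 𝓘(ℝ, F₂))) (fun b : B ↦ (x, (a, b))) b Z)
      (mfderiv 𝓘(ℝ, F₂) (𝓘(ℝ, E₁).prod (𝓘(ℝ, F₁).prod 𝓘(ℝ, F₂))) (fun b : B ↦ (x, (a, b))) b W) =
    f x ^ 2 * g₂.inner (a, b)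
      (mfderiv 𝓘(ℝ, F₂) (𝓘(ℝ, F₁).prod 𝓘(ℝ, F₂)) (fun b : B ↦ (a, b)) b Z)
      (mfderiv 𝓘(ℝ, F₂) (𝓘(ℝ, F₁).prod 𝓘(ℝ, F₂)) (fun b : B ↦ (a, b)) b W) := by
  have h1 : ∀ Z : TangentSpace 𝓘(ℝ, F₂) b,
      mfderiv (𝓘(ℝ, E₁).prod (𝓘(ℝ, F₁).prod 𝓘(ℝ, F₂))) 𝓘(ℝ, E₁) Prod.fst (x, (a, b))
        (mfderiv 𝓘(ℝ, F₂) (𝓘(ℝ, E₁).prod (𝓘(ℝ, F₁).prod 𝓘(ℝ, F₂)))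
          (fun b : B ↦ (x, (a, b))) b Z) = 0 := by
    intro Z
    have := mfderiv_comp b (f := fun b : B ↦ (x, (a, b))) (g := Prod.fst) (I := 𝓘(ℝ, F₂))
      (I' := 𝓘(ℝ, E₁).prod (𝓘(ℝ, F₁).prod 𝓘(ℝ, F₂))) (I'' := 𝓘(ℝ, E₁))
      mdifferentiableAt_fst (mdifferentiableAt_inclThird x a b)
    have h0 : mfderiv 𝓘(ℝ, F₂) 𝓘(ℝ, E₁) (Prod.fst ∘ fun b : B ↦ (x, (a, b))) b = 0 :=
      mfderiv_const
    exact (DFunLike.congr_fun (this.symm.trans h0) Z)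
  have h2 : ∀ Z : TangentSpace 𝓘(ℝ, F₂) b,
      mfderiv (𝓘(ℝ, E₁).prod (𝓘(ℝ, F₁).prod 𝓘(ℝ, F₂))) (𝓘(ℝ, F₁).prod 𝓘(ℝ, F₂)) Prod.snd (x, (a, b))
        (mfderiv 𝓘(ℝ, F₂) (𝓘(ℝ, E₁).prod (𝓘(ℝ, F₁).prod 𝓘(ℝ, F₂)))
          (fun b : B ↦ (x, (a, b))) b Z) =
      mfderiv 𝓘(ℝ, F₂) (𝓘(ℝ, F₁).prod 𝓘(ℝ, F₂)) (fun b : B ↦ (a, b)) b Z := by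
    intro Z
    have := mfderiv_comp b (f := fun b : B ↦ (x, (a, b))) (g := Prod.snd) (I := 𝓘(ℝ, F₂))
      (I' := 𝓘(ℝ, E₁).prod (𝓘(ℝ, F₁).prod 𝓘(ℝ, F₂))) (I'' := 𝓘(ℝ, F₁).prod 𝓘(ℝ, F₂))
      mdifferentiableAt_snd (mdifferentiableAt_inclThird x a b)
    exact (DFunLike.congr_fun this Z).symm
  rw [warpedMetric, h1, h1, h2, h2]
  simp

/-- The inclusion of the leaf has the left inverse `Prod.snd`, so its differential is injective. -/
lemma inner_inclSecond_pos
    (g₂ : ContMDiffRiemannianMetric (𝓘(ℝ, F₁).prod 𝓘(ℝ, F₂)) ∞ (F₁ × F₂)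
      (fun y : A × B ↦ TangentSpace (𝓘(ℝ, F₁).prod 𝓘(ℝ, F₂)) y))
    (a : A) (b : B) {Z : TangentSpace 𝓘(ℝ, F₂) b} (hZ : Z ≠ 0) :
    0 < g₂.inner (a, b)
      (mfderiv 𝓘(ℝ, F₂) (𝓘(ℝ, F₁).prod 𝓘(ℝ, F₂)) (fun b : B ↦ (a, b)) b Z)
      (mfderiv 𝓘(ℝ, F₂) (𝓘(ℝ, F₁).prod 𝓘(ℝ, F₂)) (fun b : B ↦ (a, b)) b Z) := by
  refine g₂.pos _ _ fun h ↦ hZ ?_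
  have h1 := mfderiv_comp b (f := fun b : B ↦ (a, b)) (g := Prod.snd) (I := 𝓘(ℝ, F₂))
    (I' := 𝓘(ℝ, F₁).prod 𝓘(ℝ, F₂)) (I'' := 𝓘(ℝ, F₂))
    mdifferentiableAt_snd (mdifferentiableAt_const.prodMk mdifferentiableAt_id)
  have h2 := DFunLike.congr_fun
    (((mfderiv_id (I := 𝓘(ℝ, F₂)) (x := b)) : mfderiv 𝓘(ℝ, F₂) 𝓘(ℝ, F₂)
      (Prod.snd ∘ fun b : B ↦ (a, b)) b = _).symm.trans h1) Z
  refine h2.trans ?_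
  rw [ContinuousLinearMap.comp_apply, h, map_zero]

end Leaves

/-! ### Orthogonality relations of a quasi bi-slant submanifold -/

section QuasiBiSlant

set_option linter.unusedSectionVars false

variable {E : Type*} [NormedAddCommGroup E] [NormedSpace ℝ E] [FiniteDimensional ℝ E]
  {N : Type*} [TopologicalSpace N] [ChartedSpace E N] [IsManifold 𝓘(ℝ, E) ∞ N]
  [RiemannianBundle (fun x : N ↦ TangentSpace 𝓘(ℝ, E) x)]
  [IsContMDiffRiemannianBundle 𝓘(ℝ, E) ∞ E (fun x : N ↦ TangentSpace 𝓘(ℝ, E) x)]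
  {J : ∀ x : N, TangentSpace 𝓘(ℝ, E) x →L[ℝ] TangentSpace 𝓘(ℝ, E) x}
  {F : Type*} [NormedAddCommGroup F] [NormedSpace ℝ F]
  {H : Type*} [TopologicalSpace H] {I : ModelWithCorners ℝ F H}
  {M : Type*} [TopologicalSpace M] [ChartedSpace H M] {χ : M → N}
  {D D₁ D₂ : ∀ p : M, Submodule ℝ (TangentSpace I p)} {θ₁ θ₂ : ℝ}

/-- Invariance keeps `J u` in `D`, which is orthogonal to `D₂`. This is the vanishing of the mixed
part of the Kaehler form. -/
lemma IsQuasiBiSlant.inner_map_eq_zero (h : IsQuasiBiSlant J χ D D₁ D₂ θ₁ θ₂) {p : M}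
    {u v : TangentSpace 𝓘(ℝ, E) (χ p)} (hu : u ∈ push χ D p) (hv : v ∈ push χ D₂ p) :
    (inner ℝ (J (χ p) u) v : ℝ) = 0 := by
  refine h.splitting.ortho_two p _ ?_ v hv
  have := h.invariant p
  rw [← this]
  exact ⟨u, hu, rfl⟩

/-- A tangent vector splits along `D`, `D₁`, `D₂`. Skewness turns `J D ⊥ D₂` and `J D₁ ⊥ D₂` into
orthogonality of `J D₂` to `D` and `D₁`; the right angle handles `D₂` itself. -/
lemma IsQuasiBiSlant.isAntiInvariantDistribution (hJ : IsKaehler J)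
    (h : IsQuasiBiSlant J χ D D₁ D₂ θ₁ (Real.pi / 2)) : IsAntiInvariantDistribution J χ D₂ := by
  intro p u hu v
  have hv : v ∈ D p ⊔ D₁ p ⊔ D₂ p := by rw [h.splitting.sup_eq_top]; trivial
  obtain ⟨w, hw, w₂, hw₂, rfl⟩ := Submodule.mem_sup.1 hv
  obtain ⟨w₀, hw₀, w₁, hw₁, rfl⟩ := Submodule.mem_sup.1 hw
  have h₀ : (inner ℝ (J (χ p) u) (mfderiv I 𝓘(ℝ, E) χ p w₀) : ℝ) = 0 := by
    have hm : mfderiv I 𝓘(ℝ, E) χ p w₀ ∈ push (E := E) χ D p := ⟨w₀, hw₀, rfl⟩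
    rw [hJ.inner_map_skew, h.inner_map_eq_zero hm hu, neg_zero]
  have h₁ : (inner ℝ (J (χ p) u) (mfderiv I 𝓘(ℝ, E) χ p w₁) : ℝ) = 0 := by
    have hm : mfderiv I 𝓘(ℝ, E) χ p w₁ ∈ push (E := E) χ D₁ p := ⟨w₁, hw₁, rfl⟩
    rw [hJ.inner_map_skew, h.ortho p _ hm u hu, neg_zero]
  have h₂ : (inner ℝ (J (χ p) u) (mfderiv I 𝓘(ℝ, E) χ p w₂) : ℝ) = 0 := by
    by_cases hu0 : u = 0
    · rw [hu0, map_zero, inner_zero_left]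
    · exact inner_eq_zero_of_angleToSubspace (h.slant_two p u hu hu0) ⟨w₂, hw₂, rfl⟩
  rw [map_add, map_add, inner_add_right, inner_add_right, h₀, h₁, h₂, add_zero, add_zero]

end QuasiBiSlant

end SlantGeometry

end

/-! ### The dichotomy -/

theorem theorem6p1
    -- the ambient manifold
    {E : Type*} [NormedAddCommGroup E] [NormedSpace ℝ E] [FiniteDimensional ℝ E]
    {N : Type*} [TopologicalSpace N] [ChartedSpace E N] [IsManifold 𝓘(ℝ, E) ∞ N]
    [RiemannianBundle (fun x : N ↦ TangentSpace 𝓘(ℝ, E) x)]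
    [IsContMDiffRiemannianBundle 𝓘(ℝ, E) ∞ E (fun x : N ↦ TangentSpace 𝓘(ℝ, E) x)]
    (J : ∀ x : N, TangentSpace 𝓘(ℝ, E) x →L[ℝ] TangentSpace 𝓘(ℝ, E) x)
    (hJ : SlantGeometry.IsKaehler J)
    -- the factors `M₁`, `A = M_θ₁` and `B = M_θ₂`
    {E₁ : Type*} [NormedAddCommGroup E₁] [NormedSpace ℝ E₁] [FiniteDimensional ℝ E₁]
    {M₁ : Type*} [TopologicalSpace M₁] [ChartedSpace E₁ M₁] [IsManifold 𝓘(ℝ, E₁) ∞ M₁]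
    [ConnectedSpace M₁]
    {F₁ : Type*} [NormedAddCommGroup F₁] [NormedSpace ℝ F₁] [FiniteDimensional ℝ F₁]
    {A : Type*} [TopologicalSpace A] [ChartedSpace F₁ A] [IsManifold 𝓘(ℝ, F₁) ∞ A] [Nonempty A]
    {F₂ : Type*} [NormedAddCommGroup F₂] [NormedSpace ℝ F₂] [FiniteDimensional ℝ F₂]
    [Nontrivial F₂]
    {B : Type*} [TopologicalSpace B] [ChartedSpace F₂ B] [IsManifold 𝓘(ℝ, F₂) ∞ B] [Nonempty B]
    -- the metrics on `M₁` and on `M₂ = A × B`, and the warping function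
    (g₁ : ContMDiffRiemannianMetric 𝓘(ℝ, E₁) ∞ E₁ (fun x : M₁ ↦ TangentSpace 𝓘(ℝ, E₁) x))
    (g₂ : ContMDiffRiemannianMetric (𝓘(ℝ, F₁).prod 𝓘(ℝ, F₂)) ∞ (F₁ × F₂)
      (fun y : A × B ↦ TangentSpace (𝓘(ℝ, F₁).prod 𝓘(ℝ, F₂)) y))
    (f : M₁ → ℝ) (hf : MDifferentiable 𝓘(ℝ, E₁) 𝓘(ℝ, ℝ) f) (hf_pos : ∀ x, 0 < f x)
    -- the warped product is a quasi bi-slant submanifold of `N`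
    (χ : M₁ × (A × B) → N)
    (hχ : SlantGeometry.IsIsometricImmersion (E := E)
      (𝓘(ℝ, E₁).prod (𝓘(ℝ, F₁).prod 𝓘(ℝ, F₂)))
      (SlantGeometry.warpedMetric g₁ f g₂) χ)
    (θ₁ θ₂ : ℝ)
    (hslant : SlantGeometry.IsQuasiBiSlant J χ (SlantGeometry.tangentFirst E₁ F₁ F₂)
      (SlantGeometry.tangentSecond E₁ F₁ F₂) (SlantGeometry.tangentThird E₁ F₁ F₂) θ₁ θ₂) :
    -- `f` is constant and the warped product is a Riemannian product, or
    ((∃ c : ℝ, ∀ x, f x = c) ∧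
      ∃ h₂ : ContMDiffRiemannianMetric (𝓘(ℝ, F₁).prod 𝓘(ℝ, F₂)) ∞ (F₁ × F₂)
          (fun y : A × B ↦ TangentSpace (𝓘(ℝ, F₁).prod 𝓘(ℝ, F₂)) y),
        SlantGeometry.warpedMetric g₁ f g₂ = SlantGeometry.productMetric g₁ h₂) ∨
    -- `θ₂ = π / 2` and the warped product is quasi hemi-slant, with totally real `M_θ₂`
    (θ₂ = Real.pi / 2 ∧
      SlantGeometry.IsQuasiHemiSlant J χ (SlantGeometry.tangentFirst E₁ F₁ F₂)
        (SlantGeometry.tangentSecond E₁ F₁ F₂) (SlantGeometry.tangentThird E₁ F₁ F₂) θ₁ ∧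
      ∀ (x : M₁) (a : A),
        SlantGeometry.IsTotallyReal J (fun b : B ↦ χ (x, (a, b))) 𝓘(ℝ, F₂)) := by
  have hnorm : ∀ (y : N) (v : TangentSpace 𝓘(ℝ, E) y), ‖J y v‖ = ‖v‖ := by
    intro y v
    rw [← pow_left_inj₀ (norm_nonneg _) (norm_nonneg _) two_ne_zero, ← real_inner_self_eq_norm_sq,
      ← real_inner_self_eq_norm_sq, hJ.inner_map_map]
  -- Since `f` lives on `M₁`, one point `(a, b)` and one non-zero `Z` tangent to `M_θ₂` suffice to
  -- control it.
  obtain ⟨a⟩ := ‹Nonempty A›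
  obtain ⟨b⟩ := ‹Nonempty B›
  obtain ⟨Z, hZ⟩ := exists_ne (0 : F₂)
  have hq := SlantGeometry.inner_inclSecond_pos g₂ a b (Z := Z) hZ
  have hd : ∀ x (Z : TangentSpace 𝓘(ℝ, F₂) b),
      ‖mfderiv 𝓘(ℝ, F₂) 𝓘(ℝ, E) (fun b ↦ χ (x, (a, b))) b Z‖ ^ 2 = f x ^ 2 * g₂.inner (a, b)
        (mfderiv 𝓘(ℝ, F₂) (𝓘(ℝ, F₁).prod 𝓘(ℝ, F₂)) (fun b : B ↦ (a, b)) b Z)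
        (mfderiv 𝓘(ℝ, F₂) (𝓘(ℝ, F₁).prod 𝓘(ℝ, F₂)) (fun b : B ↦ (a, b)) b Z) := by
    intro x Z
    rw [← real_inner_self_eq_norm_sq, SlantGeometry.mfderiv_leafThird hχ.smooth]
    exact (hχ.isometric _ _ _).trans (SlantGeometry.warpedMetric_inclThird g₁ g₂ f x a b Z Z)
  have hmem := fun x u ↦ SlantGeometry.mem_push_tangentThird_iff hχ.smooth x a b u
  obtain ⟨x₀⟩ := (inferInstance : Nonempty M₁)
  by_cases hθ : Real.cos θ₂ = 0
  · right
    -- A priori `θ₂` is any real number. A non-zero vector of `D₂` realises it as an angle in `[0,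
    -- π]`, where the cosine is injective.
    have hθ₂ : θ₂ = Real.pi / 2 := by
      have hne : mfderiv 𝓘(ℝ, F₂) 𝓘(ℝ, E) (fun b ↦ χ (x₀, (a, b))) b Z ≠ 0 := by
        intro h
        have := hd x₀ Z
        rw [h, norm_zero] at this
        have hpos := mul_pos (pow_pos (hf_pos x₀) 2) hq
        linarith
      have h := hslant.slant_two (x₀, (a, b)) _ ((hmem x₀ _).2 ⟨Z, rfl⟩) hne
      refine Real.injOn_cos ?_ ⟨by positivity, by linarith [Real.pi_pos]⟩
        (hθ.trans Real.cos_pi_div_two.symm)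
      rw [← h]
      exact ⟨InnerProductGeometry.angle_nonneg _ _, InnerProductGeometry.angle_le_pi _ _⟩
    subst hθ₂
    have hanti := hslant.isAntiInvariantDistribution hJ
    refine ⟨rfl, ⟨hslant.splitting, hslant.invariant, hslant.slant_one, hanti⟩, ?_⟩
    rintro x a b u ⟨Z, -, rfl⟩ v
    have := hanti (x, (a, b)) _
      ((SlantGeometry.mem_push_tangentThird_iff hχ.smooth x a b _).2 ⟨Z, rfl⟩)
      (mfderiv 𝓘(ℝ, F₂) (𝓘(ℝ, E₁).prod (𝓘(ℝ, F₁).prod 𝓘(ℝ, F₂))) (fun b : B ↦ (x, (a, b))) b v)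
    rw [SlantGeometry.mfderiv_leafThird hχ.smooth] at this ⊢
    exact this
  · left
    have hform := hJ.pullbackForm_eq_of_mixed_eq_zero (ψ := fun x b ↦ χ (x, (a, b)))
      (hχ.smooth.comp (contMDiff_fst.prodMk (contMDiff_const.prodMk contMDiff_snd)))
      (fun x b X Z ↦ hslant.inner_map_eq_zero (p := (x, (a, b)))
        (SlantGeometry.mem_push_tangentFirst hχ.smooth x a b X)
        ((SlantGeometry.mem_push_tangentThird_iff hχ.smooth x a b _).2 ⟨Z, rfl⟩)) b
    -- The comparison of homothety factors is symmetric in the two leaves, so it gives equality.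
    have hle : ∀ x x', f x ≤ f x' := fun x x' ↦
      SlantGeometry.le_of_slant_of_inner_eq
        (d₁ := (mfderiv 𝓘(ℝ, F₂) 𝓘(ℝ, E) (fun b ↦ χ (x, (a, b))) b).toLinearMap)
        (d₂ := (mfderiv 𝓘(ℝ, F₂) 𝓘(ℝ, E) (fun b ↦ χ (x', (a, b))) b).toLinearMap)
        (hmem x) (hmem x') (hf_pos x) (hf_pos x') (hd x) (hd x') (hnorm _) (hnorm _)
        (hslant.slant_two (x, (a, b))) (hslant.slant_two (x', (a, b)))
        (fun Z W ↦ hform Z W x x') hq hθ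
    have hc : ∀ x, f x = f x₀ := fun x ↦ le_antisymm (hle _ _) (hle _ _)
    -- The metric on `M₂` absorbs the constant: it is `f(x₀)² g₂`.
    refine ⟨⟨f x₀, hc⟩, SlantGeometry.homotheticMetric g₂ (f x₀) (hf_pos x₀), ?_⟩
    funext p u v
    rw [SlantGeometry.warpedMetric, SlantGeometry.productMetric,
      SlantGeometry.homotheticMetric_inner, hc]
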